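/- **Random geometric graph with 1D (horizontal) mobility.** Fix a constant $c\ge 10$ and let $r(n)=\sqrt{5c\,\frac{\log n}{n}}$. Let $n$ agents have independent initial locations $\ell_1,\dots,\ell_n$, uniform on the unit torus (the unit square with opposite edges glued, with the Euclidean torus distance). Given the initial locations and a vector of initial values $x(0)\in\mathbb{R}^n$, gossip with unidirectional (horizontal) mobility runs as follows. At each time $t=1,2,\dots$, independently over time: (1) every agent keeps its initial vertical coordinate and independently draws a new horizontal coordinate uniformly from $[0,1]$; (2) an agent $i$ is selected uniformly at random, and it selects $j$ uniformly among the other agents at distance less than $r(n)$ from it (if there are none, nothing happens in this step); (3) $i$ and $j$ both replace their values by $\frac12(x_i(t-1)+x_j(t-1))$, and all other values are unchanged. Let $\bar x=\frac1n\sum_i x_i(0)$, and for given initial locations let $$T_{\mathrm{ave}}(n,\epsilon)=\sup_{x(0)\neq 0}\ \inf\Big\{t\in\{0,1,2,\dots\}:\ \mathbb{P}\Big(\frac{\|x(t)-\bar x\vec 1\|_2}{\|x(0)\|_2}\ge\epsilon\Big)\le\epsilon\Big\},$$ where $\mathbb{P}$ refers to the mobility and the selections. Then $$T_{\mathrm{ave}}(n,\epsilon)=\Omega\Big(\frac{n^2\log\epsilon^{-1}}{\log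 n}\Big)$$ with high probability over the initial locations. Precisely: there is a constant $C>0$, depending only on $c$, such that for every $\epsilon_0\in(0,1)$, the probability over the initial locations that $$T_{\mathrm{ave}}(n,\epsilon)\ \ge\ C\,\frac{n^2\log\epsilon^{-1}}{\log n}\qquad\text{for all }\epsilon\in(0,\epsilon_0]$$ tends to $1$ as $n\to\infty$. -/

import Mathlib

open MeasureTheory Filter Topology
open scoped ENNReal

noncomputable section

namespace MobileGossip

/-- The unit torus: the unit square with opposite edges glued. A point is
`(horizontal coordinate, vertical coordinate)`; `volume` is the uniform probability measure. -/
abbrev Torus : Type := UnitAddCircle × UnitAddCircle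

/-- Euclidean distance on the unit torus. (The norm on `UnitAddCircle` is the distance to `0`
along the circle; the default metric on the product type would be the sup metric.) -/
def torusDist (p q : Torus) : ℝ :=
  Real.sqrt (‖p.1 - q.1‖ ^ 2 + ‖p.2 - q.2‖ ^ 2)

/-- The other agents with which agent `i` can communicate when the agents' locations are `l` and
the communication radius is `r`. -/
def neighbors {n : ℕ} (r : ℝ) (l : Fin n → Torus) (i : Fin n) : Finset (Fin n) :=
  open Classical in Finset.univ.filter fun k => k ≠ i ∧ torusDist (l i) (l k) < r

/-- Conditional probability that the selected agent `i` picks agent `j`: uniform on the neighbors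
of `i`. If `i` has no neighbor it picks itself, which leaves all values unchanged. -/
def pickProb {n : ℕ} (r : ℝ) (l : Fin n → Torus) (i j : Fin n) : ℝ≥0∞ :=
  open Classical in
  if neighbors r l i = ∅ then (if j = i then 1 else 0)
  else if j ∈ neighbors r l i then ((neighbors r l i).card : ℝ≥0∞)⁻¹ else 0

/-- The outcome of one time step: the new locations of all agents, the selected agent, and the
agent it picks. -/
abbrev Round (n : ℕ) : Type := (Fin n → Torus) × (Fin n × Fin n)

/-- Law of one time step under the mobility pattern `μ`: the locations `l k` are drawn
independently from `μ k`, an agent `i` is selected uniformly (probability `1 / n`) and it picks `j`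
with probability `pickProb r l i j`. -/
def roundLaw {n : ℕ} (r : ℝ) (μ : Fin n → Measure Torus) : Measure (Round n) :=
  ((Measure.pi μ).prod Measure.count).withDensity fun ω =>
    (n : ℝ≥0∞)⁻¹ * pickProb r ω.1 ω.2.1 ω.2.2

/-- Pairwise averaging: agents `i` and `j` replace their values by the average of the two. -/
def exchange {n : ℕ} (i j : Fin n) (x : EuclideanSpace ℝ (Fin n)) : EuclideanSpace ℝ (Fin n) :=
  WithLp.toLp 2 fun k => if k = i ∨ k = j then (x i + x j) / 2 else x k

/-- The estimates `x(t)` after the `t` time steps with outcomes `ω 0, …, ω (t - 1)`, started from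
`x0`. -/
def estimate {n : ℕ} (x0 : EuclideanSpace ℝ (Fin n)) :
    (t : ℕ) → (Fin t → Round n) → EuclideanSpace ℝ (Fin n)
  | 0, _ => x0
  | t + 1, ω =>
      exchange (ω (Fin.last t)).2.1 (ω (Fin.last t)).2.2
        (estimate x0 t fun s => ω s.castSucc)

/-- The constant vector all of whose entries are the average of the entries of `x0`. -/
def averageVector {n : ℕ} (x0 : EuclideanSpace ℝ (Fin n)) : EuclideanSpace ℝ (Fin n) :=
  WithLp.toLp 2 fun _ => (∑ i, x0 i) / n

/-- Probability (over `t` independent time steps) that the relative error at time `t` is at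
least `ε`. -/
def errorProb {n : ℕ} (r : ℝ) (μ : Fin n → Measure Torus) (x0 : EuclideanSpace ℝ (Fin n))
    (ε : ℝ) (t : ℕ) : ℝ≥0∞ :=
  Measure.pi (fun _ : Fin t => roundLaw r μ)
    {ω | ε ≤ ‖estimate x0 t ω - averageVector x0‖ / ‖x0‖}

/-- The `ε`-averaging time: the supremum, over initial values `x0 ≠ 0`, of the first time `t` at
which the relative error is at least `ε` with probability at most `ε` (`∞` if there is no such
time). -/
def averagingTime {n : ℕ} (r : ℝ) (μ : Fin n → Measure Torus) (ε : ℝ) : ℝ≥0∞ :=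
  ⨆ (x0 : EuclideanSpace ℝ (Fin n)) (_ : x0 ≠ 0),
    ⨅ (t : ℕ) (_ : errorProb r μ x0 ε t ≤ ENNReal.ofReal ε), (t : ℝ≥0∞)

/-- Horizontal (unidirectional) mobility: the location of agent `i` has a uniformly distributed
horizontal coordinate and keeps the vertical coordinate of the initial location `l0 i`. -/
def horizontalMobility {n : ℕ} (l0 : Fin n → Torus) (i : Fin n) : Measure Torus :=
  (volume : Measure UnitAddCircle).prod (Measure.dirac (l0 i).2)

/-- The communication radius `√(5 c log n / n)`. -/
def commRadius (c : ℝ) (n : ℕ) : ℝ :=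
  Real.sqrt (5 * c * (Real.log n / n))

end MobileGossip

end

/-! ### Averaging operators and their Dirichlet form. -/

noncomputable section

namespace MobileGossip

open scoped RealInnerProductSpace

variable {n : ℕ}

/-! Horizontal mobility freezes the vertical coordinates, so agents only ever average with agents
whose heights `‖y‖` differ by at most `r(n)`. The centred heights `v` are therefore a slow test
vector: the Dirichlet form of `v` is at most `r(n)² / 2`, of order `log n / n`
(`dirichletForm_pairLaw_le`), while `‖v‖²` is at least of order `n` with high probability
(`volume_norm_heightDeviation_sq_lt_le`). The Rayleigh quotient `D` is thus of order `log n / n²`.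

Let `W` be the self-adjoint mean exchange operator and `u = W^t v`. Then `‖u‖ ≥ (1 - D)^t ‖v‖`
(`le_norm_iterate_meanExchange`) and `⟪u, x(t)⟫` has mean `‖u‖²`. For small `ε` this mean alone
makes the error exceed `ε` with probability more than `ε`. For `ε` near 1 it does not, and Chebyshev
is used instead: the variance of `⟪u, x(t)⟫` is at most `2 M² ‖u‖²` when the initial values are
bounded by `M`, so the failure probability is `O(1/n)`. -/

theorem inner_exchange (i j : Fin n) (x y : EuclideanSpace ℝ (Fin n)) :
    ⟪exchange i j x, y⟫ = ⟪x, y⟫ - (x i - x j) * (y i - y j) / 2 := by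
  have h : exchange i j x = x - ((x i - x j) / 2) •
      (EuclideanSpace.single i (1 : ℝ) - EuclideanSpace.single j (1 : ℝ)) := by
    ext k
    by_cases hi : k = i <;> by_cases hj : k = j
    · subst hi; subst hj; simp [exchange]
    · subst hi; simp [exchange, hj]; ring
    · subst hj; simp [exchange, hi]; ring
    · simp [exchange, hi, hj]
  rw [h, inner_sub_left, inner_smul_left, inner_sub_left, EuclideanSpace.inner_single_left,
    EuclideanSpace.inner_single_left]
  simp
  ring

theorem inner_exchange_right (i j : Fin n) (x y : EuclideanSpace ℝ (Fin n)) :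
    ⟪x, exchange i j y⟫ = ⟪x, y⟫ - (x i - x j) * (y i - y j) / 2 := by
  rw [real_inner_comm, inner_exchange, real_inner_comm]
  ring

theorem norm_exchange_sq (i j : Fin n) (x : EuclideanSpace ℝ (Fin n)) :
    ‖exchange i j x‖ ^ 2 = ‖x‖ ^ 2 - (x i - x j) ^ 2 / 2 := by
  have h : exchange i j x i - exchange i j x j = 0 := by simp [exchange]
  rw [← real_inner_self_eq_norm_sq, inner_exchange_right, h, inner_exchange,
    ← real_inner_self_eq_norm_sq]
  ring

theorem norm_exchange_le (i j : Fin n) (x : EuclideanSpace ℝ (Fin n)) :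
    ‖exchange i j x‖ ≤ ‖x‖ := by
  refine le_of_sq_le_sq ?_ (norm_nonneg _)
  rw [norm_exchange_sq]
  nlinarith [sq_nonneg (x i - x j)]

theorem abs_exchange_le (i j : Fin n) {x : EuclideanSpace ℝ (Fin n)} {M : ℝ}
    (hx : ∀ k, |x k| ≤ M) (k : Fin n) : |exchange i j x k| ≤ M := by
  by_cases h : k = i ∨ k = j
  · have hi := abs_le.1 (hx i)
    have hj := abs_le.1 (hx j)
    simp only [exchange, h, if_true]
    exact abs_le.2 ⟨by linarith, by linarith⟩
  · simpa only [exchange, h, if_false] using hx k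

/-- The estimates after a sequence of exchanges between the listed pairs of agents. -/
def iterExchange (x0 : EuclideanSpace ℝ (Fin n)) :
    (t : ℕ) → (Fin t → Fin n × Fin n) → EuclideanSpace ℝ (Fin n)
  | 0, _ => x0
  | t + 1, ω =>
      exchange (ω (Fin.last t)).1 (ω (Fin.last t)).2 (iterExchange x0 t fun s => ω s.castSucc)

theorem estimate_eq_iterExchange (x0 : EuclideanSpace ℝ (Fin n)) (t : ℕ) (ω : Fin t → Round n) :
    estimate x0 t ω = iterExchange x0 t fun s => (ω s).2 := by
  induction t with
  | zero => rfl
  | succ t ih => simp only [estimate, iterExchange, ih]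

theorem norm_iterExchange_le (x0 : EuclideanSpace ℝ (Fin n)) (t : ℕ)
    (ω : Fin t → Fin n × Fin n) : ‖iterExchange x0 t ω‖ ≤ ‖x0‖ := by
  induction t with
  | zero => exact le_rfl
  | succ t ih => exact (norm_exchange_le _ _ _).trans (ih _)

theorem abs_iterExchange_le {x0 : EuclideanSpace ℝ (Fin n)} {M : ℝ} (hx : ∀ k, |x0 k| ≤ M)
    (t : ℕ) (ω : Fin t → Fin n × Fin n) (k : Fin n) : |iterExchange x0 t ω k| ≤ M := by
  induction t generalizing k with
  | zero => exact hx k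
  | succ t ih => exact abs_exchange_le _ _ (fun k => ih _ k) k

/-- The expected result of one exchange between a pair of agents of law `ν`. -/
def meanExchange (ν : Measure (Fin n × Fin n)) (x : EuclideanSpace ℝ (Fin n)) :
    EuclideanSpace ℝ (Fin n) :=
  ∑ p, ν.real {p} • exchange p.1 p.2 x

/-- The Dirichlet form of the random pair of law `ν`. -/
def dirichletForm (ν : Measure (Fin n × Fin n)) (x y : EuclideanSpace ℝ (Fin n)) : ℝ :=
  ∑ p, ν.real {p} * ((x p.1 - x p.2) * (y p.1 - y p.2) / 2)

theorem dirichletForm_comm (ν : Measure (Fin n × Fin n)) (x y : EuclideanSpace ℝ (Fin n)) :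
    dirichletForm ν x y = dirichletForm ν y x :=
  Finset.sum_congr rfl fun _ _ => by ring

variable (ν : Measure (Fin n × Fin n)) [IsProbabilityMeasure ν]

theorem sum_real_singleton : ∑ p, ν.real {p} = 1 := by
  rw [sum_measureReal_singleton]
  simp

theorem inner_meanExchange (x y : EuclideanSpace ℝ (Fin n)) :
    ⟪meanExchange ν x, y⟫ = ⟪x, y⟫ - dirichletForm ν x y := by
  simp only [meanExchange, dirichletForm, sum_inner, real_inner_smul_left, inner_exchange, mul_sub,
    Finset.sum_sub_distrib, ← Finset.sum_mul, sum_real_singleton, one_mul]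

theorem inner_meanExchange_comm (x y : EuclideanSpace ℝ (Fin n)) :
    ⟪meanExchange ν x, y⟫ = ⟪x, meanExchange ν y⟫ := by
  rw [real_inner_comm (meanExchange ν y) x, inner_meanExchange, inner_meanExchange,
    dirichletForm_comm, real_inner_comm y x]

/-- Each exchange is an orthogonal projection, and `W` is an average of projections, so convexity of
the squared norm gives `‖W x‖² ≤ ⟪W x, x⟫`. -/
theorem norm_meanExchange_sq_le (x : EuclideanSpace ℝ (Fin n)) :
    ‖meanExchange ν x‖ ^ 2 ≤ ‖x‖ ^ 2 - dirichletForm ν x x := by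
  set y := meanExchange ν x with hy
  have h1 : ‖y‖ ^ 2 = ∑ p, ν.real {p} * ⟪exchange p.1 p.2 x, y⟫ := by
    rw [← real_inner_self_eq_norm_sq]
    conv_lhs => rw [hy]
    simp only [meanExchange, sum_inner, real_inner_smul_left]
    rfl
  have h2 : ∑ p, ν.real {p} * ⟪exchange p.1 p.2 x, y⟫ ≤
      ∑ p, ν.real {p} * ((‖exchange p.1 p.2 x‖ ^ 2 + ‖y‖ ^ 2) / 2) := by
    refine Finset.sum_le_sum fun p _ => mul_le_mul_of_nonneg_left ?_ measureReal_nonneg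
    have := real_inner_le_norm (exchange p.1 p.2 x) y
    nlinarith [sq_nonneg (‖exchange p.1 p.2 x‖ - ‖y‖)]
  have h3 : ∑ p, ν.real {p} * ((‖exchange p.1 p.2 x‖ ^ 2 + ‖y‖ ^ 2) / 2) =
      ((‖x‖ ^ 2 - dirichletForm ν x x) + ‖y‖ ^ 2) / 2 := by
    have e : ∀ p : Fin n × Fin n, ν.real {p} * ((‖exchange p.1 p.2 x‖ ^ 2 + ‖y‖ ^ 2) / 2) =
        ν.real {p} * ((‖x‖ ^ 2 + ‖y‖ ^ 2) / 2) -
          ν.real {p} * ((x p.1 - x p.2) * (x p.1 - x p.2) / 2) / 2 := fun p => by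
      rw [norm_exchange_sq]; ring
    simp only [e, Finset.sum_sub_distrib, ← Finset.sum_mul, ← Finset.sum_div, sum_real_singleton,
      dirichletForm]
    ring
  linarith

theorem iterate_meanExchange_inner_comm (t : ℕ) (x y : EuclideanSpace ℝ (Fin n)) :
    ⟪(meanExchange ν)^[t] x, y⟫ = ⟪x, (meanExchange ν)^[t] y⟫ := by
  induction t generalizing x with
  | zero => rfl
  | succ t ih =>
    rw [Function.iterate_succ_apply, ih, inner_meanExchange_comm, Function.iterate_succ_apply']

/-- Self-adjointness and Cauchy–Schwarz make `t ↦ ‖W^t v‖` log-convex, so its successive ratios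
never decrease; the first ratio is at least `1 - D` by the Rayleigh quotient bound. -/
theorem le_norm_iterate_meanExchange {v : EuclideanSpace ℝ (Fin n)} {D : ℝ} (hv : v ≠ 0)
    (hD : dirichletForm ν v v ≤ D * ‖v‖ ^ 2) (hD1 : D < 1) (t : ℕ) :
    (1 - D) ^ t * ‖v‖ ≤ ‖(meanExchange ν)^[t] v‖ := by
  set b : ℕ → ℝ := fun t => ‖(meanExchange ν)^[t] v‖ with hb
  have hb0 : b 0 = ‖v‖ := rfl
  have hpos : 0 < ‖v‖ := norm_pos_iff.2 hv
  have hconv : ∀ t, b (t + 1) ^ 2 ≤ b t * b (t + 2) := fun t => by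
    simp only [hb]
    rw [← real_inner_self_eq_norm_sq, Function.iterate_succ_apply' _ t, inner_meanExchange_comm,
      Function.iterate_succ_apply' _ (t + 1), Function.iterate_succ_apply' _ t]
    exact real_inner_le_norm _ _
  have key : ∀ t, 0 < b t ∧ (1 - D) * b t ≤ b (t + 1) := by
    intro t
    induction t with
    | zero =>
      refine ⟨hpos, ?_⟩
      have h1 := real_inner_le_norm (meanExchange ν v) v
      rw [inner_meanExchange, real_inner_self_eq_norm_sq] at h1
      have h2 : b (0 + 1) = ‖meanExchange ν v‖ := rfl
      rw [h2, hb0]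
      by_contra hc
      push Not at hc
      nlinarith
    | succ t ih =>
      have h1 : 0 < b (t + 1) := lt_of_lt_of_le (mul_pos (by linarith) ih.1) ih.2
      refine ⟨h1, ?_⟩
      by_contra hc
      push Not at hc
      have h2 := hconv t
      have h3 : b t * b (t + 2) < b t * ((1 - D) * b (t + 1)) := mul_lt_mul_of_pos_left hc ih.1
      have h4 := mul_le_mul_of_nonneg_right ih.2 h1.le
      nlinarith
  induction t with
  | zero => simp
  | succ t ih =>
    have h := mul_le_mul_of_nonneg_left ih (sub_nonneg.2 hD1.le)
    calc _ = (1 - D) * ((1 - D) ^ t * ‖v‖) := by ring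
      _ ≤ _ := h.trans (key t).2

/-! ### First and second moments of linear functionals of the estimates. -/

theorem integral_iterExchange_succ (x0 : EuclideanSpace ℝ (Fin n))
    (φ : EuclideanSpace ℝ (Fin n) → ℝ) (t : ℕ) :
    ∫ ω, φ (iterExchange x0 (t + 1) ω) ∂Measure.pi (fun _ => ν) =
      ∫ ω, (∑ p, ν.real {p} * φ (exchange p.1 p.2 (iterExchange x0 t ω)))
        ∂Measure.pi (fun _ => ν) := by
  have hmp := (measurePreserving_piFinSuccAbove (fun _ : Fin (t + 1) => ν) (Fin.last t)).symm
  rw [← hmp.integral_comp' (g := fun ω => φ (iterExchange x0 (t + 1) ω)),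
    integral_prod_symm _ .of_finite]
  refine integral_congr_ae (ae_of_all _ fun ω => ?_)
  simp only
  rw [integral_fintype .of_finite]
  refine Finset.sum_congr rfl fun p _ => ?_
  simp [iterExchange, MeasurableEquiv.piFinSuccAbove]

theorem integral_inner_iterExchange (x0 w : EuclideanSpace ℝ (Fin n)) (t : ℕ) :
    ∫ ω, ⟪w, iterExchange x0 t ω⟫ ∂Measure.pi (fun _ => ν) = ⟪(meanExchange ν)^[t] w, x0⟫ := by
  induction t generalizing w with
  | zero => simp [iterExchange]
  | succ t ih =>
    rw [integral_iterExchange_succ ν x0 (fun x => ⟪w, x⟫), Function.iterate_succ_apply, ← ih]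
    refine integral_congr_ae (ae_of_all _ fun ω => ?_)
    simp only [inner_meanExchange_comm]
    simp only [meanExchange, inner_sum, real_inner_smul_right]

/-- The one-step variance is at most `2 M²` times the Dirichlet form of `w`, because values in `[-M,
M]` differ by at most `2 M`. Bounding that form by the drop of `‖w‖²` under `W` makes the errors
telescope over time. -/
theorem sum_mul_inner_exchange_sq_le (w : EuclideanSpace ℝ (Fin n))
    {x : EuclideanSpace ℝ (Fin n)} {M : ℝ} (hx : ∀ k, |x k| ≤ M) :
    ∑ p, ν.real {p} * ⟪w, exchange p.1 p.2 x⟫ ^ 2 ≤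
      ⟪meanExchange ν w, x⟫ ^ 2 + 2 * M ^ 2 * (‖w‖ ^ 2 - ‖meanExchange ν w‖ ^ 2) := by
  have e : ∀ p : Fin n × Fin n, ν.real {p} * ⟪w, exchange p.1 p.2 x⟫ ^ 2 =
      ν.real {p} * ⟪w, x⟫ ^ 2
        - ν.real {p} * ((w p.1 - w p.2) * (x p.1 - x p.2) / 2) * (2 * ⟪w, x⟫)
        + ν.real {p} * ((w p.1 - w p.2) * (x p.1 - x p.2) / 2) ^ 2 := fun p => by
    rw [inner_exchange_right]; ring
  have h1 : ∑ p, ν.real {p} * ((w p.1 - w p.2) * (x p.1 - x p.2) / 2) ^ 2 ≤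
      2 * M ^ 2 * dirichletForm ν w w := by
    rw [dirichletForm, Finset.mul_sum]
    refine Finset.sum_le_sum fun p _ => ?_
    have h2 : (x p.1 - x p.2) ^ 2 ≤ (2 * M) ^ 2 := by
      refine sq_le_sq.2 ?_
      have hi := hx p.1
      have hj := hx p.2
      have := abs_sub (x p.1) (x p.2)
      rw [abs_of_nonneg (by linarith [abs_nonneg (x p.1)] : 0 ≤ 2 * M)]
      linarith
    calc _ = ν.real {p} * ((w p.1 - w p.2) ^ 2 / 4 * (x p.1 - x p.2) ^ 2) := by ring
      _ ≤ ν.real {p} * ((w p.1 - w p.2) ^ 2 / 4 * (2 * M) ^ 2) := by gcongr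
      _ = _ := by ring
  have h3 : dirichletForm ν w w ≤ ‖w‖ ^ 2 - ‖meanExchange ν w‖ ^ 2 := by
    linarith [norm_meanExchange_sq_le ν w]
  have h4 := mul_le_mul_of_nonneg_left h3 (by positivity : 0 ≤ 2 * M ^ 2)
  simp only [e, Finset.sum_add_distrib, Finset.sum_sub_distrib, ← Finset.sum_mul,
    sum_real_singleton]
  rw [inner_meanExchange]
  change 1 * ⟪w, x⟫ ^ 2 - dirichletForm ν w x * (2 * ⟪w, x⟫) + _ ≤ _
  nlinarith [sq_nonneg (dirichletForm ν w x)]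

theorem integral_inner_iterExchange_sq_le (w : EuclideanSpace ℝ (Fin n))
    {x0 : EuclideanSpace ℝ (Fin n)} {M : ℝ} (hx : ∀ k, |x0 k| ≤ M) (t : ℕ) :
    ∫ ω, ⟪w, iterExchange x0 t ω⟫ ^ 2 ∂Measure.pi (fun _ => ν) ≤
      ⟪(meanExchange ν)^[t] w, x0⟫ ^ 2 +
        2 * M ^ 2 * (‖w‖ ^ 2 - ‖(meanExchange ν)^[t] w‖ ^ 2) := by
  induction t generalizing w with
  | zero => simp [iterExchange]
  | succ t ih =>
    rw [integral_iterExchange_succ ν x0 (fun x => ⟪w, x⟫ ^ 2), Function.iterate_succ_apply]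
    have h1 := integral_mono (μ := Measure.pi (fun _ : Fin t => ν)) .of_finite .of_finite
      fun ω => sum_mul_inner_exchange_sq_le ν w (abs_iterExchange_le hx t ω)
    have h2 := ih (meanExchange ν w)
    rw [integral_add .of_finite .of_finite, integral_const, probReal_univ, one_smul] at h1
    linarith

/-- First moment bound: the relative norm is large with some probability. -/
theorem pow_sub_le_real_norm_iterExchange {v : EuclideanSpace ℝ (Fin n)} {D ε : ℝ} (hv : v ≠ 0)
    (hD : dirichletForm ν v v ≤ D * ‖v‖ ^ 2) (hD1 : D < 1) (hε : 0 ≤ ε) (t : ℕ) :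
    (1 - D) ^ t - ε ≤
      (Measure.pi fun _ => ν).real {ω | ε ≤ ‖iterExchange v t ω‖ / ‖v‖} := by
  have hpos : 0 < ‖v‖ := norm_pos_iff.2 hv
  set u := (meanExchange ν)^[t] v with hu
  have hb := le_norm_iterate_meanExchange ν hv hD hD1 t
  have hbpos : 0 < ‖u‖ := lt_of_lt_of_le (mul_pos (pow_pos (by linarith) _) hpos) hb
  set S := {ω | ε ≤ ‖iterExchange v t ω‖ / ‖v‖} with hS
  have hSm : MeasurableSet S := S.toFinite.measurableSet
  have h1 := integral_inner_iterExchange ν v u t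
  -- Testing against `u = W^t v` itself turns the mean into `⟪W^t u, v⟫ = ⟪u, W^t v⟫ = ‖u‖²`.
  rw [iterate_meanExchange_inner_comm, ← hu, real_inner_self_eq_norm_sq] at h1
  have h2 : ∀ ω, ⟪u, iterExchange v t ω⟫ ≤
      S.indicator (fun _ => ‖u‖ * ‖v‖) ω + ‖u‖ * (ε * ‖v‖) := fun ω => by
    have h := real_inner_le_norm u (iterExchange v t ω)
    by_cases hω : ω ∈ S
    · rw [Set.indicator_of_mem hω]
      have := mul_le_mul_of_nonneg_left (norm_iterExchange_le v t ω) hbpos.le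
      have : 0 ≤ ‖u‖ * (ε * ‖v‖) := by positivity
      linarith
    · rw [Set.indicator_of_notMem hω, zero_add]
      simp only [hS, Set.mem_ofPred_eq, not_le] at hω
      rw [div_lt_iff₀ hpos] at hω
      exact h.trans (mul_le_mul_of_nonneg_left hω.le hbpos.le)
  have h3 := integral_mono (μ := Measure.pi (fun _ : Fin t => ν)) .of_finite .of_finite h2
  rw [h1, integral_add .of_finite .of_finite, integral_const, probReal_univ, one_smul,
    integral_indicator_const _ hSm, smul_eq_mul] at h3
  have h4 : ‖u‖ ≤ ((Measure.pi fun _ => ν).real S + ε) * ‖v‖ := by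
    by_contra hc
    push Not at hc
    have := mul_lt_mul_of_pos_left hc hbpos
    nlinarith
  have h5 := le_of_mul_le_mul_right (hb.trans h4) hpos
  linarith

/-- Second moment bound: the relative norm is unlikely to be far below its typical value. -/
theorem real_norm_iterExchange_lt_le {v : EuclideanSpace ℝ (Fin n)} {D ε δ M : ℝ} (hv : v ≠ 0)
    (hD : dirichletForm ν v v ≤ D * ‖v‖ ^ 2) (hD1 : D < 1) (hδ : 0 < δ)
    (hM : ∀ k, |v k| ≤ M) (t : ℕ) (ht : ε + δ ≤ (1 - D) ^ t) :
    (Measure.pi fun _ => ν).real {ω | ε ≤ ‖iterExchange v t ω‖ / ‖v‖}ᶜ ≤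
      2 * M ^ 2 / (δ * ‖v‖) ^ 2 := by
  have hpos : 0 < ‖v‖ := norm_pos_iff.2 hv
  set u := (meanExchange ν)^[t] v with hu
  have hb := le_norm_iterate_meanExchange ν hv hD hD1 t
  rw [← hu] at hb
  have hbpos : 0 < ‖u‖ := lt_of_lt_of_le (mul_pos (pow_pos (by linarith) _) hpos) hb
  set S := {ω | ε ≤ ‖iterExchange v t ω‖ / ‖v‖} with hS
  have hSm : MeasurableSet Sᶜ := Sᶜ.toFinite.measurableSet
  have h1 := integral_inner_iterExchange ν v u t
  have h2 := integral_inner_iterExchange_sq_le ν u hM t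
  rw [iterate_meanExchange_inner_comm, ← hu, real_inner_self_eq_norm_sq] at h1 h2
  -- Chebyshev: the right side is `(⟪u, x(t)⟫ - ‖u‖²)²`, and off `S` the deviation is at least `‖u‖
  -- δ ‖v‖`.
  have h3 : ∀ ω, Sᶜ.indicator (fun _ => (‖u‖ * (δ * ‖v‖)) ^ 2) ω ≤
      ⟪u, iterExchange v t ω⟫ ^ 2 - 2 * ‖u‖ ^ 2 * ⟪u, iterExchange v t ω⟫ +
        (‖u‖ ^ 2) ^ 2 := fun ω => by
    have h := real_inner_le_norm u (iterExchange v t ω)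
    by_cases hω : ω ∈ S
    · rw [Set.indicator_of_notMem (by simpa using hω)]
      nlinarith [sq_nonneg (⟪u, iterExchange v t ω⟫ - ‖u‖ ^ 2)]
    · rw [Set.indicator_of_mem (by simpa using hω)]
      simp only [hS, Set.mem_ofPred_eq, not_le] at hω
      rw [div_lt_iff₀ hpos] at hω
      have h4 : ‖u‖ * (δ * ‖v‖) ≤ ‖u‖ ^ 2 - ⟪u, iterExchange v t ω⟫ := by
        have h5 : δ * ‖v‖ ≤ ‖u‖ - ‖iterExchange v t ω‖ := by
          have := mul_le_mul_of_nonneg_right ht hpos.le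
          linarith
        have := mul_le_mul_of_nonneg_left h5 hbpos.le
        nlinarith
      have := pow_le_pow_left₀ (by positivity) h4 2
      linarith
  have h4 := integral_mono (μ := Measure.pi (fun _ : Fin t => ν)) .of_finite .of_finite h3
  rw [integral_add .of_finite .of_finite, integral_sub .of_finite .of_finite, integral_const_mul,
    h1, integral_const, probReal_univ, one_smul, integral_indicator_const _ hSm, smul_eq_mul] at h4
  have h5 : 0 ≤ 2 * M ^ 2 * ‖(meanExchange ν)^[t] u‖ ^ 2 := by positivity
  rw [le_div_iff₀ (by positivity)]
  have h6 : (Measure.pi fun _ => ν).real Sᶜ * (δ * ‖v‖) ^ 2 * ‖u‖ ^ 2 ≤ 2 * M ^ 2 * ‖u‖ ^ 2 := by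
    nlinarith
  exact le_of_mul_le_mul_right h6 (by positivity)

end MobileGossip

end

/-! ### The law of the meeting pair under horizontal mobility. -/

noncomputable section

namespace MobileGossip

open scoped RealInnerProductSpace

variable {n : ℕ}

instance isProbabilityMeasure_unitAddCircle :
    IsProbabilityMeasure (volume : Measure UnitAddCircle) :=
  ⟨by simp⟩

theorem mem_neighbors {r : ℝ} {l : Fin n → Torus} {i k : Fin n} :
    k ∈ neighbors r l i ↔ k ≠ i ∧ torusDist (l i) (l k) < r := by
  simp [neighbors]

/-- The probability is a function of the neighbor set, which has finitely many values, each cut out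
by finitely many distance conditions. -/
theorem measurable_pickProb (r : ℝ) (i j : Fin n) :
    Measurable fun l : Fin n → Torus => pickProb r l i j := by
  let _ : MeasurableSpace (Finset (Fin n)) := ⊤
  have h : Measurable fun l : Fin n → Torus => neighbors r l i := by
    refine measurable_to_countable' fun s => ?_
    have e : (fun l : Fin n → Torus => neighbors r l i) ⁻¹' {s} =
        ⋂ k, {l | (k ≠ i ∧ torusDist (l i) (l k) < r) ↔ k ∈ s} := by
      ext l
      simp only [Set.mem_preimage, Set.mem_singleton_iff, Finset.ext_iff, mem_neighbors,
        Set.mem_iInter, Set.mem_ofPred_eq]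
    rw [e]
    refine MeasurableSet.iInter fun k => ?_
    have hd : Measurable fun l : Fin n → Torus => torusDist (l i) (l k) := by
      unfold torusDist
      fun_prop
    have hm : MeasurableSet {l : Fin n → Torus | torusDist (l i) (l k) < r} :=
      measurableSet_lt hd measurable_const
    by_cases hk : k ∈ s <;> by_cases hi : k = i
    · simp [hi]
    · simpa only [ne_eq, hk, hi, not_false_eq_true, true_and, iff_true] using hm
    · simp [hi]
    · simp only [ne_eq, hk, hi, not_false_eq_true, true_and, iff_false]
      exact hm.compl
  classical
  have hg : Measurable fun s : Finset (Fin n) =>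
      if s = ∅ then (if j = i then (1 : ℝ≥0∞) else 0)
      else if j ∈ s then (s.card : ℝ≥0∞)⁻¹ else 0 := measurable_from_top
  convert hg.comp h using 1
  funext l
  simp only [pickProb, Function.comp]

theorem sum_pickProb (r : ℝ) (l : Fin n → Torus) (i : Fin n) : ∑ j, pickProb r l i j = 1 := by
  classical
  by_cases h : neighbors r l i = ∅
  · simp [pickProb, h]
  · simp only [pickProb, h, if_false]
    rw [Finset.sum_ite_mem, Finset.univ_inter, Finset.sum_const, nsmul_eq_mul]
    exact ENNReal.mul_inv_cancel (by simpa using h) (by simp)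

theorem measurable_roundDensity (r : ℝ) :
    Measurable fun ω : Round n => (n : ℝ≥0∞)⁻¹ * pickProb r ω.1 ω.2.1 ω.2.2 :=
  (measurable_from_prod_countable_left fun p => measurable_pickProb r p.1 p.2).const_mul _

theorem isProbabilityMeasure_roundLaw (hn : n ≠ 0) (r : ℝ) (μ : Fin n → Measure Torus)
    [∀ i, IsProbabilityMeasure (μ i)] : IsProbabilityMeasure (roundLaw r μ) := by
  constructor
  rw [roundLaw, withDensity_apply _ MeasurableSet.univ, Measure.restrict_univ,
    lintegral_prod _ (measurable_roundDensity r).aemeasurable]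
  have h : ∀ l : Fin n → Torus,
      ∫⁻ p : Fin n × Fin n, (n : ℝ≥0∞)⁻¹ * pickProb r l p.1 p.2 ∂Measure.count = 1 := fun l => by
    rw [lintegral_count, tsum_fintype, Fintype.sum_prod_type]
    simp only [← Finset.mul_sum, sum_pickProb]
    simp only [Finset.sum_const, Finset.card_univ, Fintype.card_fin, nsmul_eq_mul, mul_one]
    exact ENNReal.inv_mul_cancel (by simpa using hn) (by simp)
  simp only [h, lintegral_const, measure_univ, mul_one]

/-- The law of the pair of agents that meet in one time step. -/
def pairLaw (r : ℝ) (μ : Fin n → Measure Torus) : Measure (Fin n × Fin n) :=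
  (roundLaw r μ).map Prod.snd

theorem isProbabilityMeasure_pairLaw (hn : n ≠ 0) (r : ℝ) (μ : Fin n → Measure Torus)
    [∀ i, IsProbabilityMeasure (μ i)] : IsProbabilityMeasure (pairLaw r μ) := by
  have := isProbabilityMeasure_roundLaw hn r μ
  exact Measure.isProbabilityMeasure_map measurable_snd.aemeasurable

instance isProbabilityMeasure_horizontalMobility (l0 : Fin n → Torus) (i : Fin n) :
    IsProbabilityMeasure (horizontalMobility l0 i) := by
  unfold horizontalMobility
  infer_instance

/-- The estimates see only who meets whom, so the locations can be integrated out; on the resulting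
finite space measurability and integrability are automatic. -/
theorem errorProb_eq_pairLaw (hn : n ≠ 0) (r : ℝ) (μ : Fin n → Measure Torus)
    [∀ i, IsProbabilityMeasure (μ i)] (x0 : EuclideanSpace ℝ (Fin n)) (ε : ℝ) (t : ℕ) :
    errorProb r μ x0 ε t = (Measure.pi fun _ : Fin t => pairLaw r μ)
      {ω | ε ≤ ‖iterExchange x0 t ω - averageVector x0‖ / ‖x0‖} := by
  have h1 := isProbabilityMeasure_roundLaw hn r μ
  have h2 := isProbabilityMeasure_pairLaw hn r μ
  have h3 : (Measure.pi fun _ : Fin t => pairLaw r μ) =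
      (Measure.pi fun _ : Fin t => roundLaw r μ).map fun ω s => (ω s).2 := by
    have : ∀ _ : Fin t, SigmaFinite ((roundLaw r μ).map Prod.snd) := fun _ =>
      inferInstanceAs (SigmaFinite (pairLaw r μ))
    exact (Measure.pi_map_pi fun _ => measurable_snd.aemeasurable).symm
  rw [h3, Measure.map_apply (by fun_prop) (Set.toFinite _).measurableSet]
  simp only [errorProb, estimate_eq_iterExchange]
  rfl

theorem ae_roundLaw_horizontalMobility {r : ℝ} (hr : 0 ≤ r) (l0 : Fin n → Torus) :
    ∀ᵐ ω ∂roundLaw r (horizontalMobility l0),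
      |‖(l0 ω.2.1).2‖ - ‖(l0 ω.2.2).2‖| ≤ r := by
  rw [roundLaw, ae_withDensity_iff (measurable_roundDensity r)]
  have h1 : ∀ k, ∀ᵐ p ∂horizontalMobility l0 k, p.2 = (l0 k).2 := fun k =>
    Measure.quasiMeasurePreserving_snd.ae (p := fun y => y = (l0 k).2)
      ((ae_dirac_iff (measurableSet_singleton _)).2 rfl)
  have h2 : ∀ᵐ l ∂Measure.pi (horizontalMobility l0), ∀ k, (l k).2 = (l0 k).2 :=
    ae_all_iff.2 fun k => (Measure.quasiMeasurePreserving_eval _ k).ae (h1 k)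
  filter_upwards [Measure.quasiMeasurePreserving_fst.ae h2] with ω hω hne
  -- An isolated agent picks itself, and then the height difference is 0.
  rcases eq_or_ne ω.2.2 ω.2.1 with heq | hij
  · simpa [heq] using hr
  have hpick : pickProb r ω.1 ω.2.1 ω.2.2 ≠ 0 := right_ne_zero_of_mul hne
  have hmem : ω.2.2 ∈ neighbors r ω.1 ω.2.1 := by
    by_contra hmem
    exact hpick (by simp [pickProb, hij, hmem])
  have hd := (mem_neighbors.1 hmem).2
  rw [← hω, ← hω]
  calc _ ≤ ‖(ω.1 ω.2.1).2 - (ω.1 ω.2.2).2‖ := abs_norm_sub_norm_le _ _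
    _ ≤ torusDist (ω.1 ω.2.1) (ω.1 ω.2.2) := Real.le_sqrt_of_sq_le (by
        have := sq_nonneg ‖(ω.1 ω.2.1).1 - (ω.1 ω.2.2).1‖
        linarith)
    _ ≤ r := hd.le

theorem dirichletForm_pairLaw_le (hn : n ≠ 0) {r : ℝ} (hr : 0 ≤ r) (l0 : Fin n → Torus)
    {v : EuclideanSpace ℝ (Fin n)} {a : ℝ} (hv : ∀ k, v k = ‖(l0 k).2‖ - a) :
    dirichletForm (pairLaw r (horizontalMobility l0)) v v ≤ r ^ 2 / 2 := by
  have hprob := isProbabilityMeasure_pairLaw hn r (horizontalMobility l0)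
  set ν := pairLaw r (horizontalMobility l0) with hν
  have hae : ∀ᵐ p ∂ν, |‖(l0 p.1).2‖ - ‖(l0 p.2).2‖| ≤ r := by
    rw [hν, pairLaw, ae_map_iff measurable_snd.aemeasurable (Set.toFinite _).measurableSet]
    exact ae_roundLaw_horizontalMobility hr l0
  rw [ae_iff_of_countable] at hae
  calc dirichletForm ν v v ≤ ∑ p, ν.real {p} * (r ^ 2 / 2) := by
        refine Finset.sum_le_sum fun p _ => ?_
        by_cases h : ν {p} = 0
        · simp [measureReal_def, h]
        · refine mul_le_mul_of_nonneg_left ?_ measureReal_nonneg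
          have h1 := sq_le_sq' (neg_le_of_abs_le (hae p h)) (le_of_abs_le (hae p h))
          rw [hv, hv]
          nlinarith
    _ = r ^ 2 / 2 := by rw [← Finset.sum_mul, sum_real_singleton, one_mul]

end MobileGossip

end

/-! ### The heights are spread out with high probability. -/

noncomputable section

namespace MobileGossip

/-- Chebyshev's inequality for the number of independent samples that fall into a set. -/
theorem pi_sum_indicator_lt_le {Ω : Type*} [MeasurableSpace Ω] (μ : Measure Ω)
    [IsProbabilityMeasure μ] {A : Set Ω} (hA : MeasurableSet A) (hμA : 0 < μ.real A) {n : ℕ}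
    (hn : n ≠ 0) :
    (Measure.pi fun _ : Fin n => μ)
        {l | ∑ i, A.indicator (fun _ => (1 : ℝ)) (l i) < n * μ.real A / 2} ≤
      ENNReal.ofReal (4 / (n * μ.real A)) := by
  set X : Ω → ℝ := A.indicator fun _ => 1 with hX
  set P := Measure.pi fun _ : Fin n => μ with hP
  have hn' : (0 : ℝ) < n := by positivity
  have hXm : Measurable X := measurable_const.indicator hA
  have hX2 : MemLp X 2 μ := memLp_indicator_const 2 hA 1 (Or.inr (measure_ne_top _ _))
  have hXi : ∀ i : Fin n, MemLp (fun l : Fin n → Ω => X (l i)) 2 P := fun i =>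
    hX2.comp_measurePreserving (measurePreserving_eval _ i)
  have hsum : MemLp (∑ i : Fin n, fun l : Fin n → Ω => X (l i)) 2 P :=
    memLp_finsetSum' _ fun i _ => hXi i
  have hmean : ∫ l, ∑ i : Fin n, X (l i) ∂P = n * μ.real A := by
    rw [integral_finsetSum _ fun i _ => (hXi i).integrable (by norm_num)]
    have : ∀ i : Fin n, ∫ l : Fin n → Ω, X (l i) ∂P = μ.real A := fun i => by
      rw [hP, integral_comp_eval (μ := fun _ => μ) (f := X) hXm.aestronglyMeasurable,
        hX, integral_indicator_const _ hA, smul_eq_mul, mul_one]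
    simp [this]
  have hvar1 : ProbabilityTheory.variance X μ ≤ μ.real A := by
    refine (ProbabilityTheory.variance_le_expectation_sq hXm.aestronglyMeasurable).trans ?_
    have : X ^ 2 = X := by
      ext ω
      by_cases h : ω ∈ A <;> simp [hX, h]
    rw [this, hX, integral_indicator_const _ hA, smul_eq_mul, mul_one]
  have hvar : ProbabilityTheory.variance (∑ i : Fin n, fun l : Fin n → Ω => X (l i)) P ≤
      n * μ.real A := by
    rw [hP, ProbabilityTheory.variance_sum_pi fun _ => hX2]
    simpa using mul_le_mul_of_nonneg_left hvar1 hn'.le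
  have hc : 0 < n * μ.real A / 2 := by positivity
  refine (measure_mono ?_).trans
    ((ProbabilityTheory.meas_ge_le_variance_div_sq hsum hc).trans (ENNReal.ofReal_le_ofReal ?_))
  · intro l hl
    simp only [Set.mem_ofPred_eq, Finset.sum_apply, hmean] at hl ⊢
    rw [le_abs]
    right
    linarith
  · rw [div_le_div_iff₀ (by positivity) (by positivity)]
    have := mul_le_mul_of_nonneg_right hvar hc.le
    nlinarith [mul_le_mul_of_nonneg_right hvar (by positivity : (0 : ℝ) ≤ n * μ.real A)]

/-- Locations whose vertical coordinate is close to `0`. -/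
def lowerStrip : Set Torus := {p | ‖p.2‖ ≤ 1 / 8}

/-- Locations whose vertical coordinate is far from `0`. -/
def upperStrip : Set Torus := {p | 3 / 8 < ‖p.2‖}

theorem measurableSet_lowerStrip : MeasurableSet lowerStrip :=
  measurableSet_le measurable_snd.norm measurable_const

theorem measurableSet_upperStrip : MeasurableSet upperStrip :=
  measurableSet_lt measurable_const measurable_snd.norm

theorem volume_norm_snd_le {a : ℝ} (ha : 2 * a ≤ 1) :
    (volume : Measure Torus) {p | ‖p.2‖ ≤ a} = ENNReal.ofReal (2 * a) := by
  have e : {p : Torus | ‖p.2‖ ≤ a} = Set.univ ×ˢ Metric.closedBall (0 : UnitAddCircle) a := by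
    ext p
    simp
  rw [e, Measure.volume_eq_prod, Measure.prod_prod, measure_univ, one_mul,
    AddCircle.volume_closedBall, min_eq_right ha]

theorem volume_real_lowerStrip : (volume : Measure Torus).real lowerStrip = 1 / 4 := by
  rw [measureReal_def, lowerStrip, volume_norm_snd_le (by norm_num), ENNReal.toReal_ofReal] <;>
    norm_num

theorem volume_real_upperStrip : (volume : Measure Torus).real upperStrip = 1 / 4 := by
  have e : upperStrip = {p : Torus | ‖p.2‖ ≤ 3 / 8}ᶜ := by
    ext p
    simp [upperStrip]
  rw [e, probReal_compl_eq_one_sub (measurableSet_le measurable_snd.norm measurable_const),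
    measureReal_def, volume_norm_snd_le (by norm_num), ENNReal.toReal_ofReal] <;> norm_num

/-- The deviations of the heights `‖y i‖` of the agents from their mean. -/
def heightDeviation {n : ℕ} (l0 : Fin n → Torus) : EuclideanSpace ℝ (Fin n) :=
  WithLp.toLp 2 fun k => ‖(l0 k).2‖ - (∑ i, ‖(l0 i).2‖) / n

theorem averageVector_heightDeviation {n : ℕ} (hn : n ≠ 0) (l0 : Fin n → Torus) :
    averageVector (heightDeviation l0) = 0 := by
  have hn' : (n : ℝ) ≠ 0 := by exact_mod_cast hn
  ext k
  simp [averageVector, heightDeviation]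
  field_simp
  simp

theorem norm_le_half (y : UnitAddCircle) : ‖y‖ ≤ 1 / 2 := by
  simpa using AddCircle.norm_le_half_period (1 : ℝ) one_ne_zero (x := y)

theorem abs_heightDeviation_le {n : ℕ} (l0 : Fin n → Torus) (k : Fin n) :
    |heightDeviation l0 k| ≤ 1 / 2 := by
  have hn : (0 : ℝ) < n := by exact_mod_cast k.pos
  have h1 : 0 ≤ (∑ i, ‖(l0 i).2‖) / n := by positivity
  have h2 : (∑ i, ‖(l0 i).2‖) / n ≤ 1 / 2 := by
    rw [div_le_iff₀ hn]
    refine (Finset.sum_le_sum fun i _ => norm_le_half (l0 i).2).trans_eq ?_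
    simp [mul_comm]
  have h3 := norm_le_half (l0 k).2
  have h4 := norm_nonneg (l0 k).2
  simp only [heightDeviation]
  exact abs_le.2 ⟨by linarith, by linarith⟩

/-- Whichever side of `1/4` the mean height lies on, all agents of the opposite strip are at least
`1/8` away from it, contributing `(n / 8) · (1 / 64)`. -/
theorem le_norm_heightDeviation_sq {n : ℕ} {l0 : Fin n → Torus}
    (h1 : (n : ℝ) / 8 ≤ ∑ i, lowerStrip.indicator (fun _ => (1 : ℝ)) (l0 i))
    (h2 : (n : ℝ) / 8 ≤ ∑ i, upperStrip.indicator (fun _ => (1 : ℝ)) (l0 i)) :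
    (n : ℝ) / 512 ≤ ‖heightDeviation l0‖ ^ 2 := by
  rw [EuclideanSpace.real_norm_sq_eq]
  set a := (∑ i, ‖(l0 i).2‖) / n with ha
  have hv : ∀ i, heightDeviation l0 i = ‖(l0 i).2‖ - a := fun i => rfl
  rcases le_total a (1 / 4) with h | h
  · calc (n : ℝ) / 512 ≤ 1 / 64 * ∑ i, upperStrip.indicator (fun _ => (1 : ℝ)) (l0 i) := by linarith
      _ ≤ _ := by
        rw [Finset.mul_sum]
        refine Finset.sum_le_sum fun i _ => ?_
        by_cases hi : l0 i ∈ upperStrip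
        · rw [Set.indicator_of_mem hi, hv]
          have : 3 / 8 < ‖(l0 i).2‖ := hi
          nlinarith
        · rw [Set.indicator_of_notMem hi, mul_zero]
          positivity
  · calc (n : ℝ) / 512 ≤ 1 / 64 * ∑ i, lowerStrip.indicator (fun _ => (1 : ℝ)) (l0 i) := by linarith
      _ ≤ _ := by
        rw [Finset.mul_sum]
        refine Finset.sum_le_sum fun i _ => ?_
        by_cases hi : l0 i ∈ lowerStrip
        · rw [Set.indicator_of_mem hi, hv]
          have : ‖(l0 i).2‖ ≤ 1 / 8 := hi
          nlinarith
        · rw [Set.indicator_of_notMem hi, mul_zero]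
          positivity

/-- Union bound over the two strips, each of measure `1/4` and each holding fewer than `n / 8`
agents with probability at most `16 / n`. -/
theorem volume_norm_heightDeviation_sq_lt_le {n : ℕ} (hn : n ≠ 0) :
    (volume : Measure (Fin n → Torus)) {l0 | ‖heightDeviation l0‖ ^ 2 < n / 512} ≤
      ENNReal.ofReal (32 / n) := by
  have h1 := pi_sum_indicator_lt_le (volume : Measure Torus) measurableSet_lowerStrip
    (by rw [volume_real_lowerStrip]; norm_num) hn
  have h2 := pi_sum_indicator_lt_le (volume : Measure Torus) measurableSet_upperStrip
    (by rw [volume_real_upperStrip]; norm_num) hn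
  rw [volume_real_lowerStrip] at h1
  rw [volume_real_upperStrip] at h2
  have e : ENNReal.ofReal (32 / n) = ENNReal.ofReal (4 / (n * (1 / 4))) +
      ENNReal.ofReal (4 / (n * (1 / 4))) := by
    rw [← ENNReal.ofReal_add (by positivity) (by positivity)]
    congr 1
    field_simp
    norm_num
  rw [e]
  refine (measure_mono fun l0 hl => ?_).trans ((measure_union_le _ _).trans (add_le_add h1 h2))
  by_contra hc
  simp only [Set.mem_union, Set.mem_ofPred_eq, not_or, not_lt] at hc hl
  have := le_norm_heightDeviation_sq (l0 := l0) (by linarith [hc.1]) (by linarith [hc.2])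
  linarith

end MobileGossip

end

/-! ### From the test vector to the averaging time. -/

noncomputable section

namespace MobileGossip

theorem exp_neg_two_mul_le_one_sub {D : ℝ} (hD0 : 0 ≤ D) (hD : D ≤ 1 / 2) :
    Real.exp (-(2 * D)) ≤ 1 - D := by
  rw [← Real.le_log_iff_exp_le (by linarith)]
  refine le_trans ?_ (Real.one_sub_inv_le_log_of_pos (by linarith))
  have h : (1 - D)⁻¹ ≤ 1 + 2 * D := by
    rw [inv_le_iff_one_le_mul₀ (by linarith)]
    nlinarith
  linarith

theorem lt_errorProb {n : ℕ} (hn : 2 ≤ n) {c : ℝ} (hc : 0 < c) {l0 : Fin n → Torus}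
    (hl : (n : ℝ) / 512 ≤ ‖heightDeviation l0‖ ^ 2) {ε₀ ε : ℝ} (hε₀ : ε₀ < 1)
    (hD : 1280 * c * (Real.log n / n ^ 2) ≤ 1 / 2)
    (hn2 : 256 / (((1 - ε₀) / 4) ^ 2 * n) < 1 - ε₀) (hε : 0 < ε) (hεε₀ : ε ≤ ε₀) {t : ℕ}
    (ht : t < 1 / (8 * (1280 * c)) * ((n : ℝ) ^ 2 * Real.log ε⁻¹ / Real.log n)) :
    ENNReal.ofReal ε <
      errorProb (commRadius c n) (horizontalMobility l0) (heightDeviation l0) ε t := by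
  have hn0 : n ≠ 0 := by omega
  have hnpos : (0 : ℝ) < n := by positivity
  have hlog : 0 < Real.log n := Real.log_pos (by exact_mod_cast hn)
  have hprob := isProbabilityMeasure_pairLaw hn0 (commRadius c n) (horizontalMobility l0)
  rw [errorProb_eq_pairLaw hn0, averageVector_heightDeviation hn0]
  simp only [sub_zero]
  set ν := pairLaw (commRadius c n) (horizontalMobility l0)
  set v := heightDeviation l0 with hv
  set D := 1280 * c * (Real.log n / n ^ 2) with hDdef
  have hDpos : 0 < D := by positivity
  have hv2 : 0 < ‖v‖ ^ 2 := lt_of_lt_of_le (by positivity) hl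
  have hv0 : v ≠ 0 := by
    intro h
    simp [h] at hv2
  have hdir : dirichletForm ν v v ≤ D * ‖v‖ ^ 2 := by
    have hr : 0 ≤ commRadius c n := Real.sqrt_nonneg _
    refine (dirichletForm_pairLaw_le hn0 hr l0 fun _ => rfl).trans ?_
    rw [commRadius, Real.sq_sqrt (by positivity)]
    -- The constant `1280` is `512 · 5 / 2`.
    calc 5 * c * (Real.log n / n) / 2 = D * (n / 512) := by
          rw [hDdef]; field_simp; norm_num
      _ ≤ _ := mul_le_mul_of_nonneg_left hl hDpos.le
  -- `s = ε^(1/4)`: the factor `1 / 8` in the time bound gives `2 D t ≤ log ε⁻¹ / 4`, hence `(1 -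
  -- D)^t ≥ s`, which leaves room above `ε`.
  set s := Real.exp (Real.log ε / 4) with hs
  have hspos : 0 < s := Real.exp_pos _
  have hs4 : s ^ 4 = ε := by
    rw [hs, ← Real.exp_nat_mul]
    push_cast
    rw [mul_div_cancel₀ _ (by norm_num), Real.exp_log hε]
  have hs1 : s < 1 := by
    rw [hs, Real.exp_lt_one_iff]
    have := Real.log_neg hε (by linarith)
    linarith
  have hpow : s ≤ (1 - D) ^ t := by
    have h1 : 2 * D * t ≤ -Real.log ε / 4 := by
      have h2 := mul_le_mul_of_nonneg_left ht.le (by positivity : 0 ≤ 2 * D)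
      rw [Real.log_inv] at h2
      refine h2.trans_eq ?_
      rw [hDdef]
      field_simp
      ring
    calc s ≤ Real.exp (-(2 * D)) ^ t := by
          rw [hs, ← Real.exp_nat_mul]
          exact Real.exp_le_exp.2 (by linarith)
      _ ≤ (1 - D) ^ t := pow_le_pow_left₀ (Real.exp_pos _).le
          (exp_neg_two_mul_le_one_sub hDpos.le hD) t
  rw [← ofReal_measureReal, ENNReal.ofReal_lt_ofReal_iff_of_nonneg hε.le]
  -- Below `1/4` one has `s > 2 ε`, so the first moment suffices. Above, the gap `s - ε ≥ (1 - ε) /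
  -- 4 ≥ δ` feeds the second moment bound.
  rcases lt_or_ge ε (1 / 4) with h | h
  · have h1 := pow_sub_le_real_norm_iterExchange ν hv0 hdir (by linarith) hε.le t
    have hs2 : s ^ 2 < 1 / 2 := by
      by_contra hc
      push Not at hc
      nlinarith
    have hsl : s < 3 / 4 := by nlinarith
    have h2 : 2 * ε < s := by
      rw [← hs4]
      have h3 : s ^ 3 < 1 / 2 := by nlinarith
      nlinarith
    linarith
  · set δ := (1 - ε₀) / 4 with hδ
    have hδpos : 0 < δ := by linarith
    have hεδ : ε + δ ≤ (1 - D) ^ t := by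
      refine le_trans ?_ hpow
      have hs2 : 1 / 2 ≤ s ^ 2 := by nlinarith
      -- Since `s < 1`, `s - s⁴ = s (1 - s³) ≥ s² (1 - s²)`.
      have h3 : s ^ 2 * (1 - s ^ 2) ≤ s - ε := by nlinarith
      have h4 : (1 - ε) / 2 ≤ 1 - s ^ 2 := by nlinarith
      nlinarith
    have h1 := real_norm_iterExchange_lt_le ν hv0 hdir (by linarith) hδpos
      (abs_heightDeviation_le l0) t hεδ
    rw [probReal_compl_eq_one_sub (Set.toFinite _).measurableSet] at h1
    have h2 : 2 * (1 / 2 : ℝ) ^ 2 / (δ * ‖v‖) ^ 2 ≤ 256 / (δ ^ 2 * n) := by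
      rw [mul_pow, div_le_div_iff₀ (by positivity) (by positivity)]
      have := mul_le_mul_of_nonneg_left hl (sq_nonneg δ)
      linarith
    linarith

theorem le_averagingTime {n : ℕ} (hn : 2 ≤ n) {c : ℝ} (hc : 0 < c) {l0 : Fin n → Torus}
    (hl : (n : ℝ) / 512 ≤ ‖heightDeviation l0‖ ^ 2) {ε₀ ε : ℝ} (hε₀ : ε₀ < 1)
    (hD : 1280 * c * (Real.log n / n ^ 2) ≤ 1 / 2)
    (hn2 : 256 / (((1 - ε₀) / 4) ^ 2 * n) < 1 - ε₀) (hε : 0 < ε) (hεε₀ : ε ≤ ε₀) :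
    ENNReal.ofReal (1 / (8 * (1280 * c)) * ((n : ℝ) ^ 2 * Real.log ε⁻¹ / Real.log n)) ≤
      averagingTime (commRadius c n) (horizontalMobility l0) ε := by
  have hv0 : heightDeviation l0 ≠ 0 := by
    intro h
    have : (0 : ℝ) < n := by positivity
    simp [h] at hl
    linarith
  refine le_trans ?_ (le_iSup₂ (heightDeviation l0) hv0)
  refine le_iInf₂ fun t ht => ?_
  by_contra hlt
  rw [not_le, ← ENNReal.ofReal_natCast,
    ENNReal.ofReal_lt_ofReal_iff_of_nonneg (by positivity)] at hlt
  exact absurd ht (not_le.2 (lt_errorProb hn hc hl hε₀ hD hn2 hε hεε₀ hlt))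

theorem tendsto_log_div_sq : Tendsto (fun n : ℕ => Real.log n / (n : ℝ) ^ 2) atTop (𝓝 0) := by
  have h := (isLittleO_log_rpow_atTop (r := 2) (by norm_num)).tendsto_div_nhds_zero
  simp only [Real.rpow_two] at h
  exact h.comp tendsto_natCast_atTop_atTop

end MobileGossip

end

theorem corollary5 (c : ℝ) (hc : 10 ≤ c) :
    ∃ C : ℝ, 0 < C ∧ ∀ ε₀ : ℝ, 0 < ε₀ → ε₀ < 1 →
      Tendsto
        (fun n : ℕ =>
          (volume : Measure (Fin n → MobileGossip.Torus))
            {l0 | ¬ ∀ ε : ℝ, 0 < ε → ε ≤ ε₀ →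
              ENNReal.ofReal (C * ((n : ℝ) ^ 2 * Real.log ε⁻¹ / Real.log n)) ≤
                MobileGossip.averagingTime (MobileGossip.commRadius c n)
                  (MobileGossip.horizontalMobility l0) ε})
        atTop (𝓝 0) := by
  have hc0 : 0 < c := by linarith
  refine ⟨1 / (8 * (1280 * c)), by positivity, fun ε₀ _ hε₀ => ?_⟩
  have hinv : Tendsto (fun n : ℕ => ((n : ℝ))⁻¹) atTop (𝓝 0) := tendsto_inv_atTop_nhds_zero_nat
  have hbound : Tendsto (fun n : ℕ => ENNReal.ofReal (32 / n)) atTop (𝓝 0) := by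
    have h := ENNReal.tendsto_ofReal (hinv.const_mul 32)
    simpa [div_eq_mul_inv] using h
  have hD : ∀ᶠ n : ℕ in atTop, 1280 * c * (Real.log n / (n : ℝ) ^ 2) ≤ 1 / 2 := by
    have h := MobileGossip.tendsto_log_div_sq.const_mul (1280 * c)
    rw [mul_zero] at h
    exact h.eventually_le_const (by norm_num)
  have hn2 : ∀ᶠ n : ℕ in atTop, 256 / (((1 - ε₀) / 4) ^ 2 * n) < 1 - ε₀ := by
    have h := hinv.const_mul (256 / ((1 - ε₀) / 4) ^ 2)
    rw [mul_zero] at h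
    filter_upwards [h.eventually_lt_const (sub_pos.2 hε₀)] with n hn
    rwa [← div_div, div_eq_mul_inv _ (n : ℝ)]
  refine tendsto_of_tendsto_of_tendsto_of_le_of_le' tendsto_const_nhds hbound
    (Eventually.of_forall fun _ => zero_le) ?_
  filter_upwards [hD, hn2, eventually_ge_atTop 2] with n hD hn2 hn
  -- One event on the heights, independent of `ε`, serves all `ε ≤ ε₀` at once; monotonicity needs
  -- no measurability of the bad set.
  refine (measure_mono fun l0 hl0 => ?_).trans
    (MobileGossip.volume_norm_heightDeviation_sq_lt_le (by omega))
  by_contra hl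
  exact hl0 fun ε hε hεε₀ =>
    MobileGossip.le_averagingTime hn hc0 (not_lt.1 hl) hε₀ hD hn2 hε hεε₀
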